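/- For $-\pi/2<\lambda<\pi/2$ let the $\lambda$-spiral segment of $w\in\mathbb C$ be $[0,w]_\lambda=\{w\exp(te^{i\lambda}):t\le 0\}\cup\{0\}$. A domain $\Omega\subset\mathbb C$ with $0\in\Omega$ is called $\lambda$-spirallike if $[0,w]_\lambda\subset\Omega$ for every $w\in\Omega$. An analytic function $f$ on the unit disk $\mathbb D$ with $f(0)=0$ is called $\lambda$-spirallike if it maps $\mathbb D$ univalently onto a $\lambda$-spirallike domain, and starlike if this holds with $\lambda=0$. For $R>0$ let $\alpha(R,f)$ be the length of the largest arc contained in $\{\zeta\in\partial\mathbb D: R\zeta\in f(\mathbb D)\}$, let $A(f)=\lim_{R\to+\infty}\alpha(R,f)$, and let $M(r,f)=\max_{|z|=r}|f(z)|$ for $0<r<1$. **Theorem.** Let $\lambda\in(-\pi/2,\pi/2)$ and $0<A<2\pi$. Then there is a $\lambda$-spirallike function $f$ with $f'(0)=1$ and $A(f)=A$ (in particular the limit defining $A(f)$ exists) such that $$M(r,f)=O\left[(1-r)^{-A\cos^2\lambda/\pi}\right]\qquad(r\to1-)$$ does not hold. Moreover, $f$ can be chosen so that $$\frac{f(z)}{z}=\left(\frac{g(z)}{z}\right)^{e^{i\lambda}\cos\lambda}\quad(0<|z|<1),\qquad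 g(z)=\frac{z}{(1-z)^{A/\pi}}\left(1+c\log\frac1{1-z}\right)^{\beta}\quad(|z|<1),$$ for some real numbers $\beta,c>0$ for which $g$ is starlike; all powers and logarithms are principal. -/

import Mathlib

open Set Filter Asymptotics
open scoped Real Topology

namespace Spirallike

/-- The `lam`-spiral segment `[0, w]`: the points `w * exp (t * e^{i lam})`, `t ≤ 0`,
together with `0`. For `lam = 0` it is the line segment from `0` to `w`. -/
def spiralSegment (lam : ℝ) (w : ℂ) : Set ℂ :=
  {v | ∃ t : ℝ, t ≤ 0 ∧ v = w * Complex.exp (t * Complex.exp (lam * Complex.I))} ∪ {0}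

/-- A domain containing `0` and, with each of its points `w`, the whole `lam`-spiral
segment from `0` to `w`. -/
structure IsSpirallikeDomain (lam : ℝ) (Ω : Set ℂ) : Prop where
  isOpen : IsOpen Ω
  isConnected : IsConnected Ω
  zero_mem : (0 : ℂ) ∈ Ω
  segment_subset : ∀ w ∈ Ω, spiralSegment lam w ⊆ Ω

/-- An analytic function on the open unit disk, vanishing at `0`, that maps the disk
univalently onto a `lam`-spirallike domain. Values outside the disk are irrelevant. -/
structure IsSpirallike (lam : ℝ) (f : ℂ → ℂ) : Prop where
  analytic : DifferentiableOn ℂ f (Metric.ball 0 1)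
  map_zero : f 0 = 0
  univalent : InjOn f (Metric.ball 0 1)
  image : IsSpirallikeDomain lam (f '' Metric.ball 0 1)

/-- Starlike functions are the case `lam = 0`. -/
def IsStarlike (g : ℂ → ℂ) : Prop := IsSpirallike 0 g

/-- `α(R, f)`: the length of the largest arc contained in the set of those points `ζ` of the unit
circle for which `R ζ` lies in the image of the unit disk under `f`. Arcs are
`{e^{is} : t < s < t + ℓ}` with `0 ≤ ℓ ≤ 2π`; including end points would not change
the supremum of the lengths, and `ℓ = 0` gives the empty arc. -/
noncomputable def arcOpening (R : ℝ) (f : ℂ → ℂ) : ℝ :=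
  sSup {ℓ : ℝ | 0 ≤ ℓ ∧ ℓ ≤ 2 * π ∧ ∃ t : ℝ, ∀ s ∈ Ioo t (t + ℓ),
    (R : ℂ) * Complex.exp (s * Complex.I) ∈ f '' Metric.ball 0 1}

/-- `A(f) = A`: the limit of `α(R, f)` as `R → +∞` exists and equals `A`. -/
def HasOpening (f : ℂ → ℂ) (A : ℝ) : Prop :=
  Tendsto (fun R : ℝ => arcOpening R f) atTop (𝓝 A)

/-- `M(r, f)`: the maximum of `|f|` on the circle `|z| = r`. -/
noncomputable def maxModulus (r : ℝ) (f : ℂ → ℂ) : ℝ :=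
  sSup ((fun z => ‖f z‖) '' Metric.sphere (0 : ℂ) r)

end Spirallike

/-! Write `f = z * exp (e^{iλ} cos λ * h z)`. In the coordinate `ζ = log z` it becomes `exp (e^{iλ}
L ζ)`, where `L ζ = e^{-iλ} ζ + cos λ * h (e^ζ)`, and `λ`-spirals become horizontal lines. The real
part of `L'` is `cos λ * (1 + Re (z h'))`. If it is positive, `L` is injective on `Re ζ < 0` and its
image is closed under left translation, so `f` is spirallike (`isSpirallike_spiralMap`); `λ = 0`
gives the starlike `g`.

The opening depends only on `h` near `1`. If `Re h → ∞` and `Im h + a * arg (1 - z) → 0` at `1`,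
with `h` bounded elsewhere, the image of `L` contains the strip `|Im w| < cos λ * a * π / 2` and far
out `f` covers asymptotically nothing beyond the corresponding spiral region. On the circle of
radius `R` this region cuts out an arc of length `a * π` centred at `tan λ * log R`
(`hasOpening_spiralMap`).

Take `h = -a log (1 - z) + β log (1 - log (1 - z))` with `a = A / π`. The second term has imaginary
part tending to `0`, so the opening is unchanged, yet it multiplies `|f|` on the positive radius by
the unbounded factor `(1 + log (1 / (1 - r))) ^ (β cos² λ)`. This refutes the `O`-bound; a small `β`
keeps `Re (1 + z h')` positive. -/

namespace Spirallike

/-! ### Derivatives with positive real part. -/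

/-- **Noshiro–Warschawski**: a function on a convex set whose derivative has positive real part
is injective. -/
theorem injOn_of_re_deriv_pos {s : Set ℂ} (hs : Convex ℝ s) {F F' : ℂ → ℂ}
    (hF : ∀ z ∈ s, HasDerivAt F (F' z) z) (hpos : ∀ z ∈ s, 0 < (F' z).re) : InjOn F s := by
  intro z hz w hw hzw
  by_contra hne
  have hd : w - z ≠ 0 := sub_ne_zero.mpr (Ne.symm hne)
  have hmem : ∀ t ∈ Icc (0 : ℝ) 1, z + t * (w - z) ∈ s := by
    intro t ht
    have := hs.add_smul_sub_mem hz hw ht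
    simpa using this
  -- Divided by `w - z`, the restriction of `F` to the segment has derivative `F'`, so its real part
  -- increases strictly.
  have hder : ∀ t ∈ Icc (0 : ℝ) 1,
      HasDerivAt (fun t : ℝ => (F (z + t * (w - z)) / (w - z)).re)
        ((F' (z + t * (w - z))).re) t := by
    intro t ht
    have h1 : HasDerivAt (fun t : ℂ => z + t * (w - z)) (w - z) (t : ℂ) := by
      simpa using ((hasDerivAt_id (t : ℂ)).mul_const (w - z)).const_add z
    have h2 := ((hF _ (hmem t ht)).comp (t : ℂ) h1).div_const (w - z)
    have h3 := h2.real_of_complex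
    simpa [hd] using h3
  have hmono : StrictMonoOn (fun t : ℝ => (F (z + t * (w - z)) / (w - z)).re) (Icc 0 1) := by
    refine strictMonoOn_of_deriv_pos (convex_Icc 0 1)
      (fun t ht => (hder t ht).continuousAt.continuousWithinAt) ?_
    intro t ht
    have ht' := interior_subset ht
    rw [(hder t ht').deriv]
    exact hpos _ (hmem t ht')
  have := hmono (left_mem_Icc.mpr zero_le_one) (right_mem_Icc.mpr zero_le_one) zero_lt_one
  simp [hzw] at this

/-- A function with derivative of positive real part on a left half-plane `Re < b`, proper on the
smaller closed half-planes, has an image that is invariant under translation to the left. -/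
theorem exists_eq_sub_of_re_deriv_pos {b : ℝ} {F : ℂ → ℂ}
    (hF : DifferentiableOn ℂ F {ζ | ζ.re < b}) (hpos : ∀ ζ : ℂ, ζ.re < b → 0 < (deriv F ζ).re)
    (hproper : ∀ r < b, ∀ C : ℝ, ∃ B : ℝ, ∀ ζ : ℂ, ζ.re ≤ r → ‖F ζ‖ ≤ C → ‖ζ‖ ≤ B)
    {ζ₀ : ℂ} (hζ₀ : ζ₀.re < b) {T : ℝ} (hT : 0 ≤ T) :
    ∃ ζ : ℂ, ζ.re ≤ ζ₀.re ∧ F ζ = F ζ₀ - T := by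
  have hopen : IsOpen {ζ : ℂ | ζ.re < b} := isOpen_lt Complex.continuous_re continuous_const
  obtain ⟨B, hB⟩ := hproper ζ₀.re hζ₀ (‖F ζ₀‖ + T)
  set K : Set ℂ := {ζ | ζ.re ≤ ζ₀.re} ∩ Metric.closedBall 0 B with hK
  have hKc : IsCompact K :=
    (isCompact_closedBall 0 B).inter_left (isClosed_le Complex.continuous_re continuous_const)
  have hKs : K ⊆ {ζ | ζ.re < b} := fun ζ hζ => lt_of_le_of_lt hζ.1 hζ₀
  have hFK : IsClosed (F '' K) := (hKc.image_of_continuousOn (hF.continuousOn.mono hKs)).isClosed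
  have hmemK : ∀ t ∈ Icc (0 : ℝ) T, ∀ ζ : ℂ, ζ.re ≤ ζ₀.re → F ζ = F ζ₀ - t → ζ ∈ K := by
    intro t ht ζ h1 h2
    refine ⟨h1, ?_⟩
    rw [mem_closedBall_zero_iff]
    refine hB ζ h1 ?_
    rw [h2]
    refine (norm_sub_le _ _).trans ?_
    rw [Complex.norm_real, Real.norm_of_nonneg ht.1]
    linarith [ht.2]
  -- Continuity method: the times `t` whose translate is attained on `K` form a closed set, which
  -- the local inverse extends to the right.
  set S : Set ℝ := (fun t : ℝ => F ζ₀ - t) ⁻¹' (F '' K) with hS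
  have hSc : IsClosed (S ∩ Icc 0 T) :=
    (hFK.preimage (by fun_prop)).inter isClosed_Icc
  have h0 : (0 : ℝ) ∈ S :=
    ⟨ζ₀, hmemK 0 (left_mem_Icc.mpr hT) ζ₀ le_rfl (by simp), by simp⟩
  have hsub : Icc 0 T ⊆ S := by
    refine hSc.Icc_subset_of_forall_exists_gt h0 ?_
    rintro t ⟨⟨ζ, hζK, hζ⟩, ht⟩ y hy
    have hζb : ζ.re < b := hKs hζK
    have hd0 : deriv F ζ ≠ 0 := by
      intro h
      have := hpos ζ hζb
      simp [h] at this
    have hstrict : HasStrictDerivAt F (deriv F ζ) ζ :=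
      ((hF.analyticAt (hopen.mem_nhds hζb)).hasStrictDerivAt)
    set ψ := hstrict.localInverse F (deriv F ζ) ζ hd0 with hψ
    have hψd : HasDerivAt ψ (deriv F ζ)⁻¹ (F ζ) := (hstrict.to_localInverse hd0).hasDerivAt
    have hψζ : ψ (F ζ) = ζ :=
      HasStrictFDerivAt.localInverse_apply_image (f := F) _
    have hright : ∀ᶠ w in 𝓝 (F ζ), F (ψ w) = w :=
      HasStrictFDerivAt.eventually_right_inverse (f := F) _
    have hline : HasDerivAt (fun s : ℂ => F ζ₀ - s) (-1) (t : ℂ) := by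
      simpa using (hasDerivAt_id (t : ℂ)).const_sub (F ζ₀)
    simp only at hζ
    rw [hζ] at hψd hright hψζ
    -- Moving the value left moves the preimage left, at rate `Re (1 / F') > 0`; hence it stays in
    -- `Re ζ ≤ Re ζ₀`.
    have hre : HasDerivAt (fun s : ℝ => (ψ (F ζ₀ - s)).re) (((deriv F ζ)⁻¹ * -1).re) t :=
      (hψd.comp (t : ℂ) hline).real_of_complex
    have hneg : (((deriv F ζ)⁻¹ * -1).re) < 0 := by
      have : 0 < ((deriv F ζ)⁻¹).re := by
        rw [Complex.inv_re]
        exact div_pos (hpos ζ hζb) (Complex.normSq_pos.mpr hd0)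
      simpa using this
    have hlt : ∀ᶠ s : ℝ in 𝓝[>] t, (ψ (F ζ₀ - s)).re < ζ.re := by
      have h1 := (hasDerivWithinAt_iff_tendsto_slope' (s := Ioi t) (by simp)).mp
        hre.hasDerivWithinAt
      filter_upwards [h1.eventually_lt_const hneg, self_mem_nhdsWithin] with s hs hst
      rw [slope_def_field, div_neg_iff] at hs
      have hst' : t < s := hst
      rw [hψζ] at hs
      rcases hs with hs | hs <;> linarith [hs.1, hs.2]
    have hri : ∀ᶠ s : ℝ in 𝓝[>] t, F (ψ (F ζ₀ - s)) = F ζ₀ - s := by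
      have : Tendsto (fun s : ℝ => F ζ₀ - (s : ℂ)) (𝓝 t) (𝓝 (F ζ₀ - t)) :=
        Continuous.tendsto (by fun_prop) t
      exact (this.eventually hright).filter_mono nhdsWithin_le_nhds
    have hyT : Ioc t (min y T) ∈ 𝓝[>] t := Ioc_mem_nhdsGT (lt_min hy ht.2)
    obtain ⟨s, hs1, hs2, hs3⟩ := (hlt.and (hri.and hyT)).exists
    exact ⟨s, ⟨ψ (F ζ₀ - s), hmemK s ⟨ht.1.trans hs3.1.le, hs3.2.trans (min_le_right _ _)⟩ _
      (hs1.le.trans hζK.1) hs2, hs2⟩, hs3.1, hs3.2.trans (min_le_left _ _)⟩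
  obtain ⟨ζ, hζ, h⟩ := hsub (right_mem_Icc.mpr hT)
  exact ⟨ζ, hζ.1, h⟩

/-! ### The logarithmic coordinate and a criterion for spirallikeness. -/

/-- The function `z * exp (e^{i lam} cos lam * h z)`. -/
noncomputable def spiralMap (lam : ℝ) (h : ℂ → ℂ) (z : ℂ) : ℂ :=
  z * Complex.exp (Complex.exp (lam * Complex.I) * (Real.cos lam : ℂ) * h z)

/-- The logarithm of `spiralMap lam h` in the coordinate `ζ = log z`, turned so that
`lam`-spirals become horizontal lines. -/
noncomputable def spiralLog (lam : ℝ) (h : ℂ → ℂ) (ζ : ℂ) : ℂ :=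
  Complex.exp (-(lam * Complex.I)) * ζ + (Real.cos lam : ℂ) * h (Complex.exp ζ)

theorem exp_spiralLog (lam : ℝ) (h : ℂ → ℂ) (ζ : ℂ) :
    Complex.exp (Complex.exp (lam * Complex.I) * spiralLog lam h ζ) =
      spiralMap lam h (Complex.exp ζ) := by
  have h1 : Complex.exp (lam * Complex.I) * Complex.exp (-(lam * Complex.I)) = 1 := by
    rw [← Complex.exp_add]; simp
  rw [spiralLog, spiralMap, ← Complex.exp_add, mul_add, ← mul_assoc, h1, one_mul, ← mul_assoc]

theorem exp_mem_ball {ζ : ℂ} (hζ : ζ.re < 0) : Complex.exp ζ ∈ Metric.ball (0 : ℂ) 1 := by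
  rw [mem_ball_zero_iff, Complex.norm_exp]
  exact (Real.exp_lt_one_iff.mpr hζ)

theorem re_log_neg {z : ℂ} (hz : z ∈ Metric.ball (0 : ℂ) 1) (h0 : z ≠ 0) :
    (Complex.log z).re < 0 := by
  rw [Complex.log_re]
  exact Real.log_neg (norm_pos_iff.mpr h0) (mem_ball_zero_iff.mp hz)

variable {lam : ℝ} {h : ℂ → ℂ}

theorem hasDerivAt_spiralLog (hh : DifferentiableOn ℂ h (Metric.ball 0 1)) {ζ : ℂ}
    (hζ : ζ.re < 0) :
    HasDerivAt (spiralLog lam h) (Complex.exp (-(lam * Complex.I)) +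
      (Real.cos lam : ℂ) * (deriv h (Complex.exp ζ) * Complex.exp ζ)) ζ := by
  have h1 : HasDerivAt h (deriv h (Complex.exp ζ)) (Complex.exp ζ) :=
    (hh.differentiableAt (Metric.isOpen_ball.mem_nhds (exp_mem_ball hζ))).hasDerivAt
  have h2 := (h1.comp ζ (Complex.hasDerivAt_exp ζ)).const_mul (Real.cos lam : ℂ)
  have h3 := ((hasDerivAt_id ζ).const_mul (Complex.exp (-(lam * Complex.I)))).add h2
  rw [mul_one] at h3
  exact h3

theorem re_deriv_spiralLog_pos (hlam : 0 < Real.cos lam)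
    (hpos : ∀ z ∈ Metric.ball (0 : ℂ) 1, 0 < 1 + (z * deriv h z).re) {ζ : ℂ} (hζ : ζ.re < 0) :
    0 < (Complex.exp (-(lam * Complex.I)) +
      (Real.cos lam : ℂ) * (deriv h (Complex.exp ζ) * Complex.exp ζ)).re := by
  have h1 : (Complex.exp (-(lam * Complex.I))).re = Real.cos lam := by
    simp [Complex.exp_re]
  rw [Complex.add_re, h1, Complex.re_ofReal_mul, mul_comm (deriv h _)]
  nlinarith [hpos _ (exp_mem_ball hζ)]

theorem injOn_spiralLog (hlam : 0 < Real.cos lam) (hh : DifferentiableOn ℂ h (Metric.ball 0 1))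
    (hpos : ∀ z ∈ Metric.ball (0 : ℂ) 1, 0 < 1 + (z * deriv h z).re) :
    InjOn (spiralLog lam h) {ζ | ζ.re < 0} :=
  injOn_of_re_deriv_pos (convex_halfSpace_re_lt 0) (fun _ hζ => hasDerivAt_spiralLog hh hζ)
    (fun _ hζ => re_deriv_spiralLog_pos hlam hpos hζ)

theorem exists_spiralLog_eq_sub (hlam : 0 < Real.cos lam)
    (hh : DifferentiableOn ℂ h (Metric.ball 0 1))
    (hpos : ∀ z ∈ Metric.ball (0 : ℂ) 1, 0 < 1 + (z * deriv h z).re)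
    {ζ₀ : ℂ} (hζ₀ : ζ₀.re < 0) {T : ℝ} (hT : 0 ≤ T) :
    ∃ ζ : ℂ, ζ.re < 0 ∧ spiralLog lam h ζ = spiralLog lam h ζ₀ - T := by
  have key := exists_eq_sub_of_re_deriv_pos (b := 0) (F := spiralLog lam h)
    (fun ζ hζ => (hasDerivAt_spiralLog hh hζ).differentiableAt.differentiableWithinAt)
    (fun ζ hζ => by
      rw [(hasDerivAt_spiralLog hh hζ).deriv]; exact re_deriv_spiralLog_pos hlam hpos hζ)
    ?_ hζ₀ hT
  · obtain ⟨ζ, h1, h2⟩ := key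
    exact ⟨ζ, h1.trans_lt hζ₀, h2⟩
  -- Properness: `h` is bounded on the closed disk of radius `e^r < 1`, and `|e^{-iλ} ζ| = |ζ|`.
  · intro r hr C
    have hsub : Metric.closedBall (0 : ℂ) (Real.exp r) ⊆ Metric.ball 0 1 :=
      Metric.closedBall_subset_ball ((Real.exp_lt_one_iff.mpr hr))
    obtain ⟨M, hM⟩ := (isCompact_closedBall (0 : ℂ) (Real.exp r)).exists_bound_of_continuousOn
      (hh.continuousOn.mono hsub)
    refine ⟨C + |Real.cos lam| * M, fun ζ hζ hC => ?_⟩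
    have h1 : ‖h (Complex.exp ζ)‖ ≤ M := by
      refine hM _ ?_
      rw [mem_closedBall_zero_iff, Complex.norm_exp]
      exact Real.exp_le_exp.mpr hζ
    have h2 : ‖ζ‖ = ‖spiralLog lam h ζ - (Real.cos lam : ℂ) * h (Complex.exp ζ)‖ := by
      rw [spiralLog, add_sub_cancel_right, norm_mul, Complex.norm_exp]
      simp
    rw [h2]
    refine (norm_sub_le _ _).trans ?_
    rw [norm_mul, Complex.norm_real, Real.norm_eq_abs]
    gcongr

theorem differentiableOn_spiralMap (hh : DifferentiableOn ℂ h (Metric.ball 0 1)) :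
    DifferentiableOn ℂ (spiralMap lam h) (Metric.ball 0 1) := by
  unfold spiralMap
  fun_prop

theorem spiralMap_zero : spiralMap lam h 0 = 0 := by simp [spiralMap]

theorem spiralMap_eq_zero {z : ℂ} : spiralMap lam h z = 0 ↔ z = 0 := by
  simp [spiralMap, Complex.exp_ne_zero]

theorem spiralLog_add_two_pi (n : ℤ) (ζ : ℂ) :
    spiralLog lam h (ζ + n * (2 * π * Complex.I)) =
      spiralLog lam h ζ + Complex.exp (-(lam * Complex.I)) * (n * (2 * π * Complex.I)) := by
  rw [spiralLog, spiralLog, Complex.exp_add, Complex.exp_int_mul_two_pi_mul_I]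
  ring_nf

/-- Two logarithms of one value differ by `2πin`. Since `h ∘ exp` is `2πi`-periodic, shifting `ζ` by
`2πin` absorbs the difference. -/
theorem eq_spiralLog_of_exp_eq {w ζ : ℂ}
    (hw : Complex.exp (Complex.exp (lam * Complex.I) * w) = spiralMap lam h (Complex.exp ζ)) :
    ∃ n : ℤ, w = spiralLog lam h (ζ + n * (2 * π * Complex.I)) := by
  have h1 : Complex.exp (-(lam * Complex.I)) * Complex.exp (lam * Complex.I) = 1 := by
    rw [← Complex.exp_add]; simp
  rw [← exp_spiralLog, Complex.exp_eq_exp_iff_exists_int] at hw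
  obtain ⟨n, hn⟩ := hw
  refine ⟨n, ?_⟩
  rw [spiralLog_add_two_pi]
  linear_combination Complex.exp (-(lam * Complex.I)) * hn + (spiralLog lam h ζ - w) * h1

theorem injOn_spiralMap (hlam : 0 < Real.cos lam) (hh : DifferentiableOn ℂ h (Metric.ball 0 1))
    (hpos : ∀ z ∈ Metric.ball (0 : ℂ) 1, 0 < 1 + (z * deriv h z).re) :
    InjOn (spiralMap lam h) (Metric.ball 0 1) := by
  intro z hz w hw hzw
  by_cases hz0 : z = 0
  · subst hz0
    rw [spiralMap_zero] at hzw
    exact (spiralMap_eq_zero.mp hzw.symm).symm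
  have hw0 : w ≠ 0 := by
    rintro rfl
    rw [spiralMap_zero] at hzw
    exact hz0 (spiralMap_eq_zero.mp hzw)
  have he : Complex.exp (Complex.exp (lam * Complex.I) * spiralLog lam h (Complex.log z)) =
      spiralMap lam h (Complex.exp (Complex.log w)) := by
    rw [exp_spiralLog, Complex.exp_log hz0, Complex.exp_log hw0, hzw]
  obtain ⟨n, hn⟩ := eq_spiralLog_of_exp_eq he
  have := injOn_spiralLog hlam hh hpos (re_log_neg hz hz0)
    (show (Complex.log w + n * (2 * π * Complex.I)).re < 0 by simpa using re_log_neg hw hw0) hn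
  rw [← Complex.exp_log hz0, this, Complex.exp_add, Complex.exp_int_mul_two_pi_mul_I, mul_one,
    Complex.exp_log hw0]

/-- A sufficient condition for spirallikeness: `Re (1 + z h'(z)) > 0` on the disk. -/
theorem isSpirallike_spiralMap (hlam : 0 < Real.cos lam)
    (hh : DifferentiableOn ℂ h (Metric.ball 0 1))
    (hpos : ∀ z ∈ Metric.ball (0 : ℂ) 1, 0 < 1 + (z * deriv h z).re) :
    IsSpirallike lam (spiralMap lam h) := by
  have hdiff := differentiableOn_spiralMap (lam := lam) hh
  have hinj := injOn_spiralMap hlam hh hpos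
  have hconn : IsConnected (Metric.ball (0 : ℂ) 1) :=
    ((convex_ball (0 : ℂ) 1).isPathConnected ⟨0, by simp⟩).isConnected
  refine ⟨hdiff, spiralMap_zero, hinj, ?_, hconn.image _ hdiff.continuousOn,
    ⟨0, by simp, spiralMap_zero⟩, ?_⟩
  · have han : AnalyticOnNhd ℂ (spiralMap lam h) (Metric.ball 0 1) :=
      hdiff.analyticOnNhd Metric.isOpen_ball
    rcases han.is_constant_or_isOpen hconn.isPreconnected with ⟨w, hw⟩ | ho
    · have h0 : (0 : ℂ) ∈ Metric.ball (0 : ℂ) 1 := by simp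
      have h1 : (1 / 2 : ℂ) ∈ Metric.ball (0 : ℂ) 1 := by
        rw [mem_ball_zero_iff]; norm_num
      have := hinj h0 h1 ((hw _ h0).trans (hw _ h1).symm)
      norm_num at this
    · exact ho _ subset_rfl Metric.isOpen_ball
  · rintro _ ⟨z, hz, rfl⟩ v (⟨t, ht, rfl⟩ | hv)
    · by_cases hz0 : z = 0
      · exact ⟨0, by simp, by simp [hz0, spiralMap_zero]⟩
      -- Parameter `t ≤ 0` on the spiral is left translation by `-t` in the logarithmic coordinate.
      obtain ⟨ζ, h1, h2⟩ := exists_spiralLog_eq_sub hlam hh hpos (re_log_neg hz hz0)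
        (neg_nonneg.mpr ht)
      refine ⟨Complex.exp ζ, exp_mem_ball h1, ?_⟩
      rw [← exp_spiralLog, h2, Complex.ofReal_neg, sub_neg_eq_add, mul_add, Complex.exp_add,
        exp_spiralLog, Complex.exp_log hz0, mul_comm (t : ℂ)]
    · rw [mem_singleton_iff.mp hv]
      exact ⟨0, by simp, spiralMap_zero⟩

end Spirallike

/-! ### The opening, from the behaviour of `h` near `1`. -/

namespace Spirallike

theorem one_sub_re_pos {z : ℂ} (hz : z ∈ Metric.ball (0 : ℂ) 1) : 0 < (1 - z).re := by
  have h1 := Complex.re_le_norm z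
  have h2 := mem_ball_zero_iff.mp hz
  simp only [Complex.sub_re, Complex.one_re]
  linarith

theorem one_sub_mem_slitPlane {z : ℂ} (hz : z ∈ Metric.ball (0 : ℂ) 1) :
    1 - z ∈ Complex.slitPlane :=
  Or.inl (one_sub_re_pos hz)

theorem one_sub_ne_zero {z : ℂ} (hz : z ∈ Metric.ball (0 : ℂ) 1) : 1 - z ≠ 0 :=
  Complex.slitPlane_ne_zero (one_sub_mem_slitPlane hz)

theorem abs_arg_one_sub_lt {z : ℂ} (hz : z ∈ Metric.ball (0 : ℂ) 1) :
    |(1 - z).arg| < π / 2 :=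
  Complex.abs_arg_lt_pi_div_two_iff.mpr (Or.inl (one_sub_re_pos hz))

variable {lam a : ℝ} {h : ℂ → ℂ}

theorem eventually_nhdsWithin_ball_ne_zero : ∀ᶠ z in 𝓝[Metric.ball (0 : ℂ) 1] 1, z ≠ 0 :=
  (isOpen_ne.eventually_mem one_ne_zero).filter_mono nhdsWithin_le_nhds

theorem tendsto_exp_mul_log_one (lam : ℝ) :
    Tendsto (fun z => Complex.exp (-(lam * Complex.I)) * Complex.log z)
      (𝓝[Metric.ball (0 : ℂ) 1] 1) (𝓝 0) := by
  have h1 : Tendsto Complex.log (𝓝 1) (𝓝 0) := by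
    have := (continuousAt_clog (x := 1) (by simp)).tendsto
    rwa [Complex.log_one] at this
  have := (h1.mono_left (nhdsWithin_le_nhds (s := Metric.ball (0 : ℂ) 1))).const_mul
    (Complex.exp (-(lam * Complex.I)))
  rwa [mul_zero] at this

/-- The linear term `e^{-iλ} log z` vanishes at `z = 1`, so only `cos λ * h` matters. -/
theorem tendsto_spiralLog_log_im
    (him : Tendsto (fun z => (h z).im + a * (1 - z).arg) (𝓝[Metric.ball (0 : ℂ) 1] 1) (𝓝 0)) :
    Tendsto (fun z => (spiralLog lam h (Complex.log z)).im + Real.cos lam * (a * (1 - z).arg))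
      (𝓝[Metric.ball (0 : ℂ) 1] 1) (𝓝 0) := by
  have h1 := (Complex.continuous_im.tendsto 0).comp (tendsto_exp_mul_log_one lam)
  have h2 := h1.add (him.const_mul (Real.cos lam))
  simp only [Complex.zero_im, mul_zero, add_zero] at h2
  refine h2.congr' ?_
  filter_upwards [eventually_nhdsWithin_ball_ne_zero] with z hz
  rw [spiralLog, Complex.exp_log hz, Complex.add_im, Complex.im_ofReal_mul]
  simp only [Function.comp_apply]
  ring

theorem tendsto_spiralLog_log_re (hlam : 0 < Real.cos lam)
    (hre : Tendsto (fun z => (h z).re) (𝓝[Metric.ball (0 : ℂ) 1] 1) atTop) :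
    Tendsto (fun z => (spiralLog lam h (Complex.log z)).re)
      (𝓝[Metric.ball (0 : ℂ) 1] 1) atTop := by
  have h1 := (Complex.continuous_re.tendsto 0).comp (tendsto_exp_mul_log_one lam)
  have h2 := h1.add_atTop (hre.const_mul_atTop hlam)
  refine h2.congr' ?_
  filter_upwards [eventually_nhdsWithin_ball_ne_zero] with z hz
  rw [spiralLog, Complex.exp_log hz, Complex.add_re, Complex.re_ofReal_mul]
  rfl

theorem tendsto_one_sub_mul_exp {θ : ℝ} (hθ : |θ| < π / 2) :
    Tendsto (fun ρ : ℝ => 1 - (ρ : ℂ) * Complex.exp (θ * Complex.I)) (𝓝[>] 0)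
      (𝓝[Metric.ball (0 : ℂ) 1] 1) := by
  have hc : 0 < Real.cos θ := Real.cos_pos_of_mem_Ioo (abs_lt.mp hθ)
  refine tendsto_nhdsWithin_iff.mpr ⟨?_, ?_⟩
  · have : Tendsto (fun ρ : ℝ => 1 - (ρ : ℂ) * Complex.exp (θ * Complex.I)) (𝓝 0)
        (𝓝 (1 - ((0 : ℝ) : ℂ) * Complex.exp (θ * Complex.I))) := Continuous.tendsto (by fun_prop) 0
    rw [Complex.ofReal_zero, zero_mul, sub_zero] at this
    exact this.mono_left nhdsWithin_le_nhds
  · filter_upwards [Ioo_mem_nhdsGT hc] with ρ hρ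
    rw [mem_ball_zero_iff, ← sq_lt_one_iff₀ (norm_nonneg _), Complex.sq_norm, Complex.normSq_apply]
    simp only [Complex.sub_re, Complex.one_re, Complex.re_ofReal_mul, Complex.exp_ofReal_mul_I_re,
      Complex.sub_im, Complex.one_im, Complex.im_ofReal_mul, Complex.exp_ofReal_mul_I_im]
    nlinarith [hρ.1, hρ.2, Real.sin_sq_add_cos_sq θ, mul_pos hρ.1 (sub_pos.mpr hρ.2),
      mul_pos hρ.1 hc]

theorem arg_one_sub_one_sub_mul_exp {θ ρ : ℝ} (hθ : |θ| < π / 2) (hρ : 0 < ρ) :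
    (1 - (1 - (ρ : ℂ) * Complex.exp (θ * Complex.I))).arg = θ := by
  obtain ⟨h1, h2⟩ := abs_lt.mp hθ
  rw [sub_sub_cancel, Complex.exp_mul_I]
  exact Complex.arg_mul_cos_add_sin_mul_I hρ ⟨by linarith [Real.pi_pos], by linarith [Real.pi_pos]⟩

/-- All horizontal lines of height less than `cos lam * (a * (π / 2))` lie in the image of
`spiralLog lam h`. -/
theorem exists_spiralLog_eq (hlam : 0 < Real.cos lam) (ha : 0 < a)
    (hh : DifferentiableOn ℂ h (Metric.ball 0 1))
    (hpos : ∀ z ∈ Metric.ball (0 : ℂ) 1, 0 < 1 + (z * deriv h z).re)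
    (him : Tendsto (fun z => (h z).im + a * (1 - z).arg) (𝓝[Metric.ball (0 : ℂ) 1] 1) (𝓝 0))
    (hre : Tendsto (fun z => (h z).re) (𝓝[Metric.ball (0 : ℂ) 1] 1) atTop)
    {w : ℂ} (hw : |w.im| < Real.cos lam * (a * (π / 2))) :
    ∃ ζ : ℂ, ζ.re < 0 ∧ spiralLog lam h ζ = w := by
  obtain ⟨y, hy1, hy2⟩ := exists_between hw
  -- Approaching `1` with `arg (1 - z) = ±θ`, the height `Im L` tends to `∓y`, on either side of `Im
  -- w`.
  set θ := y / (Real.cos lam * a) with hθ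
  have hca : 0 < Real.cos lam * a := mul_pos hlam ha
  have hθy : Real.cos lam * (a * θ) = y := by
    rw [hθ]; field_simp
  have hy0 : 0 < y := (abs_nonneg _).trans_lt hy1
  have hθ2 : |θ| < π / 2 := by
    rw [abs_of_pos (div_pos hy0 hca), div_lt_iff₀ hca]
    linarith
  have hθ3 : |-θ| < π / 2 := by rwa [abs_neg]
  have hev := ((tendsto_spiralLog_log_re (lam := lam) hlam hre).eventually_ge_atTop w.re)
  obtain ⟨δ, hδ, hδs⟩ := Metric.mem_nhdsWithin_iff.mp hev
  -- Radius at most `1` keeps `U` in the right half-plane, where the principal `log` is continuous.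
  set δ' := min δ 1 with hδ'
  have hδ'0 : 0 < δ' := lt_min hδ one_pos
  set U := Metric.ball (1 : ℂ) δ' ∩ Metric.ball (0 : ℂ) 1 with hU
  have hUn : U ∈ 𝓝[Metric.ball (0 : ℂ) 1] 1 :=
    inter_mem (mem_nhdsWithin_of_mem_nhds (Metric.ball_mem_nhds _ hδ'0)) self_mem_nhdsWithin
  have hUslit : ∀ z ∈ U, z ∈ Complex.slitPlane := by
    intro z hz
    left
    have h1 : ‖z - 1‖ < 1 := (mem_ball_iff_norm.mp hz.1).trans_le (min_le_right _ _)
    have h2 := (abs_le.mp (Complex.abs_re_le_norm (z - 1))).1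
    simp only [Complex.sub_re, Complex.one_re] at h2
    linarith
  have hUc : IsPreconnected U := ((convex_ball _ _).inter (convex_ball _ _)).isPreconnected
  have hmaps : MapsTo Complex.log U {ζ | ζ.re < 0} := fun z hz =>
    re_log_neg hz.2 (Complex.slitPlane_ne_zero (hUslit z hz))
  have hcont : ContinuousOn (fun z => (spiralLog lam h (Complex.log z)).im) U := by
    have h1 : ContinuousOn (spiralLog lam h) {ζ | ζ.re < 0} := fun ζ hζ =>
      (hasDerivAt_spiralLog hh hζ).continuousAt.continuousWithinAt
    have h2 : ContinuousOn Complex.log U := continuousOn_id.clog hUslit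
    exact Complex.continuous_im.comp_continuousOn (h1.comp h2 hmaps)
  have hlim : ∀ θ : ℝ, |θ| < π / 2 → Tendsto (fun ρ : ℝ => (spiralLog lam h (Complex.log
      (1 - (ρ : ℂ) * Complex.exp (θ * Complex.I)))).im) (𝓝[>] 0)
      (𝓝 (-(Real.cos lam * (a * θ)))) := by
    intro θ hθ
    have h1 := ((tendsto_spiralLog_log_im (lam := lam) him).comp
      (tendsto_one_sub_mul_exp hθ)).add_const (-(Real.cos lam * (a * θ)))
    rw [zero_add] at h1
    refine h1.congr' ?_
    filter_upwards [self_mem_nhdsWithin] with ρ hρ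
    simp only [Function.comp_apply]
    rw [arg_one_sub_one_sub_mul_exp hθ hρ]
    ring
  have hw' := abs_lt.mp hy1
  obtain ⟨ρ₁, h1, h1U⟩ := (((hlim θ hθ2).eventually_le_const
    (show -(Real.cos lam * (a * θ)) < w.im by rw [hθy]; exact hw'.1)).and
    ((tendsto_one_sub_mul_exp hθ2).eventually hUn)).exists
  obtain ⟨ρ₂, h2, h2U⟩ := (((hlim (-θ) hθ3).eventually_const_le
    (show w.im < -(Real.cos lam * (a * -θ)) by
      rw [mul_neg, mul_neg, neg_neg, hθy]; exact hw'.2)).and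
    ((tendsto_one_sub_mul_exp hθ3).eventually hUn)).exists
  -- This point has the height of `w` and lies to its right; left translation then reaches `w`.
  obtain ⟨z, hzU, hz⟩ := hUc.intermediate_value h1U h2U hcont ⟨h1, h2⟩
  have hzre : w.re ≤ (spiralLog lam h (Complex.log z)).re :=
    hδs ⟨Metric.ball_subset_ball (min_le_left _ _) hzU.1, hzU.2⟩
  obtain ⟨ζ, hζ, hζw⟩ := exists_spiralLog_eq_sub hlam hh hpos (hmaps hzU)
    (sub_nonneg.mpr hzre)
  refine ⟨ζ, hζ, ?_⟩
  rw [hζw]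
  apply Complex.ext
  · simp
  · simpa using hz

/-- The point of polar coordinates `(R, s)` in the turned logarithmic coordinate. -/
theorem exp_turned_log {R : ℝ} (hR : 0 < R) (lam s : ℝ) :
    Complex.exp (Complex.exp (lam * Complex.I) *
      (Complex.exp (-(lam * Complex.I)) * (Real.log R + s * Complex.I))) =
      (R : ℂ) * Complex.exp (s * Complex.I) := by
  have h1 : Complex.exp (lam * Complex.I) * Complex.exp (-(lam * Complex.I)) = 1 := by
    rw [← Complex.exp_add]; simp
  rw [← mul_assoc, h1, one_mul, Complex.exp_add, ← Complex.ofReal_exp, Real.exp_log hR]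

theorem turned_log_im (hlam : Real.cos lam ≠ 0) (x s : ℝ) :
    (Complex.exp (-(lam * Complex.I)) * (x + s * Complex.I)).im =
      Real.cos lam * (s - Real.tan lam * x) := by
  rw [Real.tan_eq_sin_div_cos]
  simp only [Complex.mul_im, Complex.exp_re, Complex.exp_im, Complex.add_re, Complex.add_im]
  simp
  field_simp
  ring

theorem mem_image_spiralMap_of_abs_lt (hlam : 0 < Real.cos lam) (ha : 0 < a)
    (hh : DifferentiableOn ℂ h (Metric.ball 0 1))
    (hpos : ∀ z ∈ Metric.ball (0 : ℂ) 1, 0 < 1 + (z * deriv h z).re)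
    (him : Tendsto (fun z => (h z).im + a * (1 - z).arg) (𝓝[Metric.ball (0 : ℂ) 1] 1) (𝓝 0))
    (hre : Tendsto (fun z => (h z).re) (𝓝[Metric.ball (0 : ℂ) 1] 1) atTop)
    {R s : ℝ} (hR : 0 < R) (hs : |s - Real.tan lam * Real.log R| < a * (π / 2)) :
    (R : ℂ) * Complex.exp (s * Complex.I) ∈ spiralMap lam h '' Metric.ball 0 1 := by
  obtain ⟨ζ, hζ, hζw⟩ := exists_spiralLog_eq hlam ha hh hpos him hre
    (w := Complex.exp (-(lam * Complex.I)) * (Real.log R + s * Complex.I)) (by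
      rw [turned_log_im hlam.ne', abs_mul, abs_of_pos hlam]
      gcongr)
  refine ⟨Complex.exp ζ, exp_mem_ball hζ, ?_⟩
  rw [← exp_spiralLog, hζw, exp_turned_log hR]

/-- A value of large modulus can only be taken near `1`, where `|arg (1 - z)| < π / 2` limits the
height of `L`; `n` records the branch of the logarithm. -/
theorem exists_int_abs_lt_of_mem_image_spiralMap (hlam : 0 < Real.cos lam) (ha : 0 < a)
    (hbdd : ∀ δ > 0, ∃ M : ℝ, ∀ z ∈ Metric.ball (0 : ℂ) 1, δ ≤ ‖1 - z‖ → ‖h z‖ ≤ M)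
    (him : Tendsto (fun z => (h z).im + a * (1 - z).arg) (𝓝[Metric.ball (0 : ℂ) 1] 1) (𝓝 0))
    {ε : ℝ} (hε : 0 < ε) :
    ∃ R₀ : ℝ, 0 < R₀ ∧ ∀ R > R₀, ∀ s : ℝ,
      (R : ℂ) * Complex.exp (s * Complex.I) ∈ spiralMap lam h '' Metric.ball 0 1 →
      ∃ n : ℤ, |s - (Real.tan lam * Real.log R + n * (2 * π))| < a * (π / 2) + ε := by
  have hev := (tendsto_spiralLog_log_im (lam := lam) him).eventually
    (Metric.ball_mem_nhds 0 (mul_pos hlam hε))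
  obtain ⟨δ, hδ, hδs⟩ := Metric.mem_nhdsWithin_iff.mp hev
  obtain ⟨M, hM⟩ := hbdd δ hδ
  refine ⟨Real.exp (|Real.cos lam| * M), Real.exp_pos _, ?_⟩
  rintro R hR s ⟨z, hz, hzR⟩
  have hR0 : 0 < R := (Real.exp_pos _).trans hR
  have hnorm : ‖spiralMap lam h z‖ = R := by
    rw [hzR, norm_mul, Complex.norm_exp_ofReal_mul_I, mul_one, Complex.norm_real,
      Real.norm_of_nonneg hR0.le]
  have hz0 : z ≠ 0 := by
    rintro rfl
    rw [spiralMap_zero, norm_zero] at hnorm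
    exact hR0.ne hnorm
  have hzδ : ‖1 - z‖ < δ := by
    by_contra! hcon
    have h1 := hM z hz hcon
    refine absurd hR (not_lt.mpr ?_)
    rw [← hnorm, spiralMap, norm_mul]
    have h2 : ‖Complex.exp (Complex.exp (lam * Complex.I) * (Real.cos lam : ℂ) * h z)‖ ≤
        Real.exp (|Real.cos lam| * M) := by
      refine (Complex.norm_exp_le_exp_norm _).trans (Real.exp_le_exp.mpr ?_)
      rw [norm_mul, norm_mul, Complex.norm_exp_ofReal_mul_I, one_mul, Complex.norm_real,
        Real.norm_eq_abs]
      gcongr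
    calc _ ≤ 1 * Real.exp (|Real.cos lam| * M) :=
          mul_le_mul (mem_ball_zero_iff.mp hz).le h2 (norm_nonneg _) zero_le_one
      _ = _ := one_mul _
  have him1 : |(spiralLog lam h (Complex.log z)).im + Real.cos lam * (a * (1 - z).arg)| <
      Real.cos lam * ε := by
    have : z ∈ Metric.ball 1 δ ∩ Metric.ball (0 : ℂ) 1 :=
      ⟨by rwa [mem_ball_iff_norm'], hz⟩
    simpa using hδs this
  obtain ⟨n, hn⟩ := eq_spiralLog_of_exp_eq (lam := lam) (h := h)
    (w := Complex.exp (-(lam * Complex.I)) * (Real.log R + s * Complex.I)) (ζ := Complex.log z)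
    (by rw [exp_turned_log hR0, Complex.exp_log hz0, hzR])
  refine ⟨n, ?_⟩
  rw [spiralLog_add_two_pi] at hn
  have hn' := congrArg Complex.im hn
  have h3 := turned_log_im hlam.ne' 0 (n * (2 * π))
  have h4 : ((0 : ℝ) : ℂ) + ((n * (2 * π) : ℝ) : ℂ) * Complex.I = n * (2 * π * Complex.I) := by
    push_cast; ring
  rw [h4] at h3
  rw [turned_log_im hlam.ne', Complex.add_im, h3] at hn'
  have harg := mul_lt_mul_of_pos_left (abs_arg_one_sub_lt hz) ha
  have h5 : Real.cos lam * (s - (Real.tan lam * Real.log R + n * (2 * π)) + a * (1 - z).arg) =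
      (spiralLog lam h (Complex.log z)).im + Real.cos lam * (a * (1 - z).arg) := by
    linear_combination hn'
  rw [← h5, abs_mul, abs_of_pos hlam] at him1
  have h6 := lt_of_mul_lt_mul_left him1 hlam.le
  have h7 := abs_sub (s - (Real.tan lam * Real.log R + n * (2 * π)) + a * (1 - z).arg)
    (a * (1 - z).arg)
  rw [add_sub_cancel_right, abs_mul, abs_of_pos ha] at h7
  linarith

/-- An open interval inside the `2π`-periodic `δ`-neighbourhood of a point, `δ < π`, has length
at most `2δ`. -/
theorem length_le_of_forall_near_periodic {t l s₀ δ : ℝ} (hδ0 : 0 ≤ δ) (hδ : δ < π)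
    (hnear : ∀ s ∈ Ioo t (t + l), ∃ n : ℤ, |s - (s₀ + n * (2 * π))| < δ) : l ≤ 2 * δ := by
  by_contra! hl
  -- The end points `s₀ + 2πk ± δ` are uncovered: their distance is `δ` from their own centre and at
  -- least `2π - δ > δ` from any other.
  have hgap : ∀ k n : ℤ, ∀ e : ℝ, |e| = δ → ¬ |(s₀ + k * (2 * π) + e) - (s₀ + n * (2 * π))| < δ := by
    intro k n e he hlt
    rcases eq_or_ne k n with rfl | hkn
    · rw [add_sub_cancel_left, he] at hlt
      exact lt_irrefl _ hlt
    · have h1 : (1 : ℝ) ≤ |((k - n : ℤ) : ℝ)| := by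
        exact_mod_cast Int.one_le_abs (sub_ne_zero.mpr hkn)
      have h2 : ((k - n : ℤ) : ℝ) * (2 * π) =
          ((s₀ + k * (2 * π) + e) - (s₀ + n * (2 * π))) - e := by
        push_cast; ring
      have h3 := abs_sub ((s₀ + k * (2 * π) + e) - (s₀ + n * (2 * π))) e
      rw [← h2, abs_mul, abs_of_pos Real.two_pi_pos, he] at h3
      nlinarith [Real.pi_pos]
  -- If `l > 2δ`, the interval contains an end point of the neighbourhood that holds its midpoint.
  obtain ⟨k, hk⟩ := hnear (t + l / 2) ⟨by linarith, by linarith⟩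
  obtain ⟨hk1, hk2⟩ := abs_lt.mp hk
  by_cases hc : s₀ + k * (2 * π) + δ < t + l
  · obtain ⟨n, hn⟩ := hnear (s₀ + k * (2 * π) + δ) ⟨by linarith, hc⟩
    exact hgap k n δ (abs_of_nonneg hδ0) hn
  · obtain ⟨n, hn⟩ := hnear (s₀ + k * (2 * π) + -δ) ⟨by linarith, by linarith⟩
    exact hgap k n (-δ) (by rw [abs_neg, abs_of_nonneg hδ0]) hn

theorem bddAbove_arcs (R : ℝ) (f : ℂ → ℂ) :
    BddAbove {ℓ : ℝ | 0 ≤ ℓ ∧ ℓ ≤ 2 * π ∧ ∃ t : ℝ, ∀ s ∈ Ioo t (t + ℓ),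
      (R : ℂ) * Complex.exp (s * Complex.I) ∈ f '' Metric.ball 0 1} :=
  ⟨2 * π, fun _ h => h.2.1⟩

theorem hasOpening_spiralMap (hlam : 0 < Real.cos lam) (ha : 0 < a) (ha2 : a < 2)
    (hh : DifferentiableOn ℂ h (Metric.ball 0 1))
    (hpos : ∀ z ∈ Metric.ball (0 : ℂ) 1, 0 < 1 + (z * deriv h z).re)
    (hbdd : ∀ δ > 0, ∃ M : ℝ, ∀ z ∈ Metric.ball (0 : ℂ) 1, δ ≤ ‖1 - z‖ → ‖h z‖ ≤ M)
    (him : Tendsto (fun z => (h z).im + a * (1 - z).arg) (𝓝[Metric.ball (0 : ℂ) 1] 1) (𝓝 0))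
    (hre : Tendsto (fun z => (h z).re) (𝓝[Metric.ball (0 : ℂ) 1] 1) atTop) :
    HasOpening (spiralMap lam h) (a * π) := by
  have hπ := Real.pi_pos
  have hlower : ∀ R > 0, a * π ≤ arcOpening R (spiralMap lam h) := by
    intro R hR
    refine le_csSup (bddAbove_arcs _ _) ⟨by positivity, by nlinarith,
      Real.tan lam * Real.log R - a * (π / 2), fun s hs => ?_⟩
    refine mem_image_spiralMap_of_abs_lt hlam ha hh hpos him hre hR (abs_lt.mpr ⟨?_, ?_⟩)
    · linarith [hs.1]
    · linarith [hs.2]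
  have hupper : ∀ ε > 0, a * (π / 2) + ε < π →
      ∀ᶠ R in atTop, arcOpening R (spiralMap lam h) ≤ 2 * (a * (π / 2) + ε) := by
    intro ε hε hεπ
    obtain ⟨R₀, -, hR₀⟩ := exists_int_abs_lt_of_mem_image_spiralMap hlam ha hbdd him hε
    filter_upwards [eventually_gt_atTop R₀] with R hR
    refine csSup_le ⟨0, le_rfl, by positivity, 0, fun s hs => ?_⟩ ?_
    · simp at hs
    · rintro l ⟨-, -, t, ht⟩
      exact length_le_of_forall_near_periodic (by positivity) hεπ fun s hs => hR₀ R hR s (ht s hs)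
  refine Metric.tendsto_nhds.mpr fun ε hε => ?_
  -- The first bound gives an error `2η < ε`; the second keeps the half-width `a * (π / 2) + η`
  -- below `π`.
  set η := min (ε / 4) ((2 - a) * π / 4) with hη
  have hη0 : 0 < η := lt_min (by positivity) (by have := sub_pos.mpr ha2; positivity)
  have hη1 : η ≤ ε / 4 := min_le_left _ _
  have hη2 : η ≤ (2 - a) * π / 4 := min_le_right _ _
  filter_upwards [hupper η hη0 (by nlinarith [mul_pos (sub_pos.mpr ha2) hπ]), eventually_gt_atTop 0]
    with R h1 h2
  rw [Real.dist_eq, abs_lt]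
  constructor <;> linarith [hlower R h2]

end Spirallike

/-! ### The extremal exponent and its growth. -/

namespace Spirallike

theorem log_norm_one_sub_lt {z : ℂ} (hz : z ∈ Metric.ball (0 : ℂ) 1) :
    Real.log ‖1 - z‖ < 7 / 10 := by
  have h1 : ‖1 - z‖ < 2 := by
    have := norm_sub_le 1 z
    rw [norm_one] at this
    linarith [mem_ball_zero_iff.mp hz]
  have := Real.log_lt_log (norm_pos_iff.mpr (one_sub_ne_zero hz)) h1
  linarith [Real.log_two_lt_d9]

theorem one_sub_log_re {z : ℂ} : (1 - Complex.log (1 - z)).re = 1 - Real.log ‖1 - z‖ := by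
  simp [Complex.log_re]

theorem one_sub_log_re_gt {z : ℂ} (hz : z ∈ Metric.ball (0 : ℂ) 1) :
    3 / 10 < (1 - Complex.log (1 - z)).re := by
  rw [one_sub_log_re]
  linarith [log_norm_one_sub_lt hz]

theorem one_sub_log_mem_slitPlane {z : ℂ} (hz : z ∈ Metric.ball (0 : ℂ) 1) :
    1 - Complex.log (1 - z) ∈ Complex.slitPlane :=
  Or.inl ((by norm_num : (0 : ℝ) < 3 / 10).trans (one_sub_log_re_gt hz))

/-- The exponent `h` of the extremal function `z * exp (h z)`: the logarithm of
`(1 - z) ^ (-a) * (1 + log (1 / (1 - z))) ^ β`. -/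
noncomputable def extremalExponent (a β : ℝ) (z : ℂ) : ℂ :=
  -(a * Complex.log (1 - z)) + β * Complex.log (1 - Complex.log (1 - z))

variable {a β : ℝ}

theorem hasDerivAt_extremalExponent {z : ℂ} (hz : z ∈ Metric.ball (0 : ℂ) 1) :
    HasDerivAt (extremalExponent a β)
      (a * (1 - z)⁻¹ + β * ((1 - z)⁻¹ / (1 - Complex.log (1 - z)))) z := by
  have h1 : HasDerivAt (fun z : ℂ => 1 - z) (-1) z := by
    simpa using (hasDerivAt_id z).const_sub 1
  have h2 := h1.clog (one_sub_mem_slitPlane hz)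
  have h3 := (h2.const_sub 1).clog (one_sub_log_mem_slitPlane hz)
  convert! (h2.const_mul (a : ℂ)).neg.add (h3.const_mul (β : ℂ)) using 1
  rw [neg_div, neg_neg, one_div]
  ring

theorem differentiableOn_extremalExponent :
    DifferentiableOn ℂ (extremalExponent a β) (Metric.ball 0 1) := fun _ hz =>
  (hasDerivAt_extremalExponent hz).differentiableAt.differentiableWithinAt

theorem inv_one_sub_re_gt {z : ℂ} (hz : z ∈ Metric.ball (0 : ℂ) 1) :
    1 / 2 < ((1 - z)⁻¹).re := by
  have h1 := mem_ball_zero_iff.mp hz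
  rw [← sq_lt_one_iff₀ (norm_nonneg _), Complex.sq_norm, Complex.normSq_apply] at h1
  rw [Complex.inv_re, lt_div_iff₀ (Complex.normSq_pos.mpr (one_sub_ne_zero hz)),
    Complex.normSq_apply]
  simp only [Complex.sub_re, Complex.one_re, Complex.sub_im, Complex.one_im]
  nlinarith

theorem inv_im_mul_arg_nonpos (w : ℂ) : (w⁻¹).im * w.arg ≤ 0 := by
  rw [Complex.inv_im, neg_div, neg_mul]
  have : 0 ≤ w.im / Complex.normSq w * w.arg := by
    rcases le_or_gt 0 w.im with hw | hw
    · exact mul_nonneg (div_nonneg hw (Complex.normSq_nonneg _)) (Complex.arg_nonneg_iff.mpr hw)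
    · exact mul_nonneg_of_nonpos_of_nonpos
        (div_nonpos_of_nonpos_of_nonneg hw.le (Complex.normSq_nonneg _))
        (Complex.arg_neg_iff.mpr hw).le
  linarith

/-- Let `u = 1 / (1 - z)` and `q = 1 - log (1 - z)`. Since `Im u` and `arg (1 - z)` have opposite
signs, the imaginary parts contribute nonnegatively. With `Re u > 1 / 2` the rest exceeds `-1 / (2
Re q)`, and `Re q > 3 / 10` because `log 2 < 7 / 10`. -/
theorem re_div_one_sub_log_gt {z : ℂ} (hz : z ∈ Metric.ball (0 : ℂ) 1) :
    -(5 / 3) < (((1 - z)⁻¹ - 1) / (1 - Complex.log (1 - z))).re := by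
  set p := (1 - Complex.log (1 - z)).re with hp
  have hp0 : 3 / 10 < p := one_sub_log_re_gt hz
  have hN : p * p ≤ Complex.normSq (1 - Complex.log (1 - z)) := by
    rw [Complex.normSq_apply]
    nlinarith [mul_self_nonneg (1 - Complex.log (1 - z)).im]
  have hN0 : 0 < Complex.normSq (1 - Complex.log (1 - z)) := by nlinarith
  have him : (1 - Complex.log (1 - z)).im = -(1 - z).arg := by
    simp [Complex.log_im]
  have hu := inv_one_sub_re_gt hz
  have harg := inv_im_mul_arg_nonpos (1 - z)
  rw [Complex.div_re, ← add_div, lt_div_iff₀ hN0, ← hp, him]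
  simp only [Complex.sub_re, Complex.one_re, Complex.sub_im ((1 - z)⁻¹), Complex.one_im]
  nlinarith

/-- The lower bound is `1 - a / 2 - 5 β / 3`, which equals `(2 - a) / 12` for this `β`. -/
theorem extremalExponent_starlike (ha : 0 < a) (ha2 : a < 2) (hβ : β = (2 - a) / 4) {z : ℂ}
    (hz : z ∈ Metric.ball (0 : ℂ) 1) : 0 < 1 + (z * deriv (extremalExponent a β) z).re := by
  rw [(hasDerivAt_extremalExponent hz).deriv]
  have hz1 : z * (1 - z)⁻¹ = (1 - z)⁻¹ - 1 := by
    have := one_sub_ne_zero hz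
    field_simp
    ring
  have : z * (a * (1 - z)⁻¹ + β * ((1 - z)⁻¹ / (1 - Complex.log (1 - z)))) =
      a * ((1 - z)⁻¹ - 1) + β * (((1 - z)⁻¹ - 1) / (1 - Complex.log (1 - z))) := by
    rw [← hz1]; ring
  rw [this, Complex.add_re, Complex.re_ofReal_mul, Complex.re_ofReal_mul, Complex.sub_re,
    Complex.one_re]
  have h1 := inv_one_sub_re_gt hz
  have h2 := re_div_one_sub_log_gt hz
  have hβ0 : 0 < β := by rw [hβ]; linarith
  nlinarith [mul_lt_mul_of_pos_left h1 ha, mul_lt_mul_of_pos_left h2 hβ0]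

theorem extremalExponent_re (z : ℂ) : (extremalExponent a β z).re =
    -(a * Real.log ‖1 - z‖) + β * Real.log ‖1 - Complex.log (1 - z)‖ := by
  simp [extremalExponent, Complex.log_re]

theorem extremalExponent_im (z : ℂ) : (extremalExponent a β z).im =
    -(a * (1 - z).arg) + β * (1 - Complex.log (1 - z)).arg := by
  simp [extremalExponent, Complex.log_im]

/-- Both arguments are below `π / 2` in modulus. The bound `π` makes `h` the principal logarithm of
`exp h`, as the power formula for `f` requires. -/
theorem abs_extremalExponent_im_lt (ha : 0 < a) (hβ : 0 < β) (haβ : a + β < 2) {z : ℂ}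
    (hz : z ∈ Metric.ball (0 : ℂ) 1) : |(extremalExponent a β z).im| < π := by
  rw [extremalExponent_im]
  have h1 := abs_arg_one_sub_lt hz
  have h2 : |(1 - Complex.log (1 - z)).arg| < π / 2 := by
    refine Complex.abs_arg_lt_pi_div_two_iff.mpr (Or.inl ?_)
    linarith [one_sub_log_re_gt hz]
  have h3 := mul_lt_mul_of_pos_left h1 ha
  have h4 := mul_lt_mul_of_pos_left h2 hβ
  refine (abs_add_le _ _).trans_lt ?_
  rw [abs_neg, abs_mul, abs_mul, abs_of_pos ha, abs_of_pos hβ]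
  nlinarith [Real.pi_pos]

theorem tendsto_log_norm_one_sub :
    Tendsto (fun z : ℂ => Real.log ‖1 - z‖) (𝓝[Metric.ball (0 : ℂ) 1] 1) atBot := by
  refine Real.tendsto_log_nhdsGT_zero.comp (tendsto_nhdsWithin_iff.mpr ⟨?_, ?_⟩)
  · have : Tendsto (fun z : ℂ => ‖1 - z‖) (𝓝 1) (𝓝 ‖(1 : ℂ) - 1‖) :=
      Continuous.tendsto (by fun_prop) 1
    rw [sub_self, norm_zero] at this
    exact this.mono_left nhdsWithin_le_nhds
  · filter_upwards [self_mem_nhdsWithin] with z hz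
    exact norm_pos_iff.mpr (one_sub_ne_zero hz)

theorem tendsto_extremalExponent_re (ha : 0 < a) (hβ : 0 < β) :
    Tendsto (fun z => (extremalExponent a β z).re) (𝓝[Metric.ball (0 : ℂ) 1] 1) atTop := by
  have h1 : Tendsto (fun z : ℂ => β * Real.log (3 / 10) + -(a * Real.log ‖1 - z‖))
      (𝓝[Metric.ball (0 : ℂ) 1] 1) atTop :=
    tendsto_atTop_add_const_left _ _
      (tendsto_neg_atBot_atTop.comp (tendsto_log_norm_one_sub.const_mul_atBot ha))
  refine tendsto_atTop_mono' _ ?_ h1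
  filter_upwards [self_mem_nhdsWithin] with z hz
  rw [extremalExponent_re, add_comm]
  have h2 : Real.log (3 / 10) ≤ Real.log ‖1 - Complex.log (1 - z)‖ :=
    Real.log_le_log (by norm_num) ((one_sub_log_re_gt hz).le.trans (Complex.re_le_norm _))
  gcongr

/-- The imaginary part of `1 - log (1 - z)` stays bounded by `π / 2` while its modulus tends to
infinity. -/
theorem tendsto_arg_one_sub_log :
    Tendsto (fun z => (1 - Complex.log (1 - z)).arg) (𝓝[Metric.ball (0 : ℂ) 1] 1) (𝓝 0) := by
  have hnorm : Tendsto (fun z => ‖1 - Complex.log (1 - z)‖)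
      (𝓝[Metric.ball (0 : ℂ) 1] 1) atTop := by
    refine tendsto_atTop_mono (fun z => Complex.re_le_norm _) ?_
    simp only [one_sub_log_re]
    exact tendsto_atTop_add_const_left _ _ (tendsto_neg_atBot_atTop.comp tendsto_log_norm_one_sub)
  have hquot : Tendsto (fun z => (1 - Complex.log (1 - z)).im / ‖1 - Complex.log (1 - z)‖)
      (𝓝[Metric.ball (0 : ℂ) 1] 1) (𝓝 0) := by
    refine squeeze_zero_norm' ?_ (hnorm.const_div_atTop (π / 2))
    filter_upwards [self_mem_nhdsWithin] with z hz
    rw [norm_div, norm_norm]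
    have : ‖(1 - Complex.log (1 - z)).im‖ ≤ π / 2 := by
      rw [Complex.sub_im, Complex.one_im, zero_sub, norm_neg, Complex.log_im]
      exact (abs_arg_one_sub_lt hz).le
    gcongr
  have h2 := (Real.continuous_arcsin.tendsto 0).comp hquot
  rw [Real.arcsin_zero] at h2
  refine h2.congr' ?_
  filter_upwards [self_mem_nhdsWithin] with z hz
  rw [Complex.arg_of_re_nonneg (by linarith [one_sub_log_re_gt hz])]
  rfl

theorem tendsto_extremalExponent_im :
    Tendsto (fun z => (extremalExponent a β z).im + a * (1 - z).arg)
      (𝓝[Metric.ball (0 : ℂ) 1] 1) (𝓝 0) := by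
  have := tendsto_arg_one_sub_log.const_mul β
  rw [mul_zero] at this
  refine this.congr fun z => ?_
  rw [extremalExponent_im]
  ring

theorem norm_log_le (w : ℂ) : ‖Complex.log w‖ ≤ |Real.log ‖w‖| + π := by
  refine (Complex.norm_le_abs_re_add_abs_im _).trans ?_
  rw [Complex.log_re, Complex.log_im]
  gcongr
  exact Complex.abs_arg_le_pi w

theorem extremalExponent_bounded {δ : ℝ} (hδ : 0 < δ) :
    ∃ M : ℝ, ∀ z ∈ Metric.ball (0 : ℂ) 1, δ ≤ ‖1 - z‖ → ‖extremalExponent a β z‖ ≤ M := by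
  have hlog : ∀ {x y b : ℝ}, 0 < x → x ≤ y → Real.log y ≤ b →
      |Real.log y| ≤ |Real.log x| + |b| := by
    intro x y b hx hxy hb
    have := Real.log_le_log hx hxy
    rw [abs_le]
    constructor
    · linarith [neg_abs_le (Real.log x), abs_nonneg b]
    · linarith [le_abs_self b, abs_nonneg (Real.log x)]
  set B := |Real.log δ| + |7 / 10| + π with hB
  refine ⟨|a| * B + |β| * (|Real.log (3 / 10)| + |Real.log (1 + B)| + π), fun z hz hzδ => ?_⟩
  have h1 : ‖Complex.log (1 - z)‖ ≤ B :=
    (norm_log_le _).trans (add_le_add_left (hlog hδ hzδ (log_norm_one_sub_lt hz).le) π)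
  have h2 : 3 / 10 ≤ ‖1 - Complex.log (1 - z)‖ :=
    (one_sub_log_re_gt hz).le.trans (Complex.re_le_norm _)
  have h3 : ‖1 - Complex.log (1 - z)‖ ≤ 1 + B := by
    refine (norm_sub_le _ _).trans ?_
    rw [norm_one]
    gcongr
  have h4 : ‖Complex.log (1 - Complex.log (1 - z))‖ ≤
      |Real.log (3 / 10)| + |Real.log (1 + B)| + π :=
    (norm_log_le _).trans (add_le_add_left
      (hlog (by norm_num) h2 (Real.log_le_log (by linarith) h3)) π)
  refine (norm_add_le _ _).trans ?_
  rw [norm_neg, norm_mul, norm_mul, Complex.norm_real, Complex.norm_real, Real.norm_eq_abs,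
    Real.norm_eq_abs]
  gcongr

theorem extremalExponent_ofReal_im {r : ℝ} (hr : r ∈ Ioo (0 : ℝ) 1) :
    (extremalExponent a β r).im = 0 := by
  have h1 : (1 - (r : ℂ)) = ((1 - r : ℝ) : ℂ) := by push_cast; ring
  have h2 : Real.log (1 - r) ≤ 0 :=
    Real.log_nonpos (by linarith [hr.2]) (by linarith [hr.1])
  rw [extremalExponent_im, h1, ← Complex.ofReal_log (by linarith [hr.2]), ← Complex.ofReal_one,
    ← Complex.ofReal_sub, Complex.arg_ofReal_of_nonneg (by linarith [hr.2]),
    Complex.arg_ofReal_of_nonneg (by linarith)]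
  simp

theorem extremalExponent_ofReal_re {r : ℝ} (hr : r ∈ Ioo (0 : ℝ) 1) :
    (extremalExponent a β r).re = -(a * Real.log (1 - r)) + β * Real.log (1 - Real.log (1 - r)) := by
  have h1 : (1 - (r : ℂ)) = ((1 - r : ℝ) : ℂ) := by push_cast; ring
  have h2 : Real.log (1 - r) ≤ 0 :=
    Real.log_nonpos (by linarith [hr.2]) (by linarith [hr.1])
  rw [extremalExponent_re, h1, ← Complex.ofReal_log (by linarith [hr.2]), ← Complex.ofReal_one,
    ← Complex.ofReal_sub, Complex.norm_real, Complex.norm_real, Real.norm_of_nonneg (by linarith [hr.2]),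
    Real.norm_of_nonneg (by linarith)]

/-- On the positive radius `h` is real, so only `Re (e^{iλ} cos λ) = cos² λ` enters the modulus. -/
theorem norm_spiralMap_extremalExponent {lam r : ℝ} (hr : r ∈ Ioo (0 : ℝ) 1) :
    ‖spiralMap lam (extremalExponent a β) r‖ =
      r * ((1 - Real.log (1 - r)) ^ (β * Real.cos lam ^ 2) *
        (1 - r) ^ (-(a * Real.cos lam ^ 2))) := by
  have h2 : Real.log (1 - r) ≤ 0 :=
    Real.log_nonpos (by linarith [hr.2]) (by linarith [hr.1])
  have h3 : (Complex.exp (lam * Complex.I) * (Real.cos lam : ℂ)).re = Real.cos lam ^ 2 := by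
    rw [Complex.re_mul_ofReal, Complex.exp_ofReal_mul_I_re, sq]
  rw [spiralMap, norm_mul, Complex.norm_real, Real.norm_of_nonneg hr.1.le, Complex.norm_exp,
    Complex.mul_re, h3, extremalExponent_ofReal_im hr, mul_zero, sub_zero,
    extremalExponent_ofReal_re hr, Real.rpow_def_of_pos (by linarith),
    Real.rpow_def_of_pos (by linarith [hr.2]), ← Real.exp_add]
  ring_nf

theorem norm_le_maxModulus {f : ℂ → ℂ} (hf : ContinuousOn f (Metric.ball 0 1)) {r : ℝ}
    (hr : r ∈ Ioo (0 : ℝ) 1) : ‖f r‖ ≤ maxModulus r f := by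
  have hsub : Metric.sphere (0 : ℂ) r ⊆ Metric.ball 0 1 := fun z hz => by
    rw [mem_ball_zero_iff, mem_sphere_zero_iff_norm.mp hz]
    exact hr.2
  refine le_csSup ((isCompact_sphere (0 : ℂ) r).bddAbove_image (hf.mono hsub).norm)
    ⟨r, ?_, rfl⟩
  rw [mem_sphere_zero_iff_norm, Complex.norm_real, Real.norm_of_nonneg hr.1.le]

theorem not_isBigO_maxModulus {lam : ℝ} (hlam : 0 < Real.cos lam) (hβ : 0 < β) :
    ¬ ((fun r : ℝ => maxModulus r (spiralMap lam (extremalExponent a β))) =O[𝓝[<] 1]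
      (fun r : ℝ => (1 - r) ^ (-(a * Real.cos lam ^ 2)))) := by
  intro hO
  obtain ⟨C, hC⟩ := hO.bound
  have hlim : Tendsto (fun r : ℝ => (1 - Real.log (1 - r)) ^ (β * Real.cos lam ^ 2)) (𝓝[<] 1)
      atTop := by
    have h1 : Tendsto (fun r : ℝ => 1 - r) (𝓝[<] 1) (𝓝[>] 0) := by
      refine tendsto_nhdsWithin_iff.mpr ⟨?_, ?_⟩
      · have : Tendsto (fun r : ℝ => 1 - r) (𝓝 1) (𝓝 (1 - 1)) := Continuous.tendsto (by fun_prop) 1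
        rw [sub_self] at this
        exact this.mono_left nhdsWithin_le_nhds
      · filter_upwards [self_mem_nhdsWithin] with r hr
        exact sub_pos.mpr (mem_Iio.mp hr)
    exact (tendsto_rpow_atTop (by positivity)).comp (tendsto_atTop_add_const_left _ _
      (tendsto_neg_atBot_atTop.comp (Real.tendsto_log_nhdsGT_zero.comp h1)))
  -- With `r > 1 / 2` and logarithmic factor above `2|C|`, their product exceeds `C`.
  obtain ⟨r, hr1, hr2, hr3⟩ := (hC.and ((hlim.eventually_gt_atTop (2 * |C|)).and
    (Ioo_mem_nhdsLT (show (1 / 2 : ℝ) < 1 by norm_num)))).exists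
  have hr : r ∈ Ioo (0 : ℝ) 1 := ⟨by linarith [hr3.1], hr3.2⟩
  have hpow : 0 < (1 - r) ^ (-(a * Real.cos lam ^ 2)) :=
    Real.rpow_pos_of_pos (by linarith [hr.2]) _
  have h1 := norm_le_maxModulus
    (differentiableOn_spiralMap (lam := lam)
      (differentiableOn_extremalExponent (a := a) (β := β))).continuousOn hr
  rw [norm_spiralMap_extremalExponent hr, ← mul_assoc] at h1
  rw [Real.norm_of_nonneg hpow.le] at hr1
  have h2 := le_of_mul_le_mul_right ((h1.trans (Real.le_norm_self _)).trans hr1) hpow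
  have h3 := abs_nonneg C
  have h4 := le_abs_self C
  nlinarith [hr3.1]

theorem deriv_spiralMap_zero {lam : ℝ} {h : ℂ → ℂ}
    (hh : DifferentiableOn ℂ h (Metric.ball 0 1)) (h0 : h 0 = 0) :
    deriv (spiralMap lam h) 0 = 1 := by
  have hd : DifferentiableAt ℂ h 0 :=
    hh.differentiableAt (Metric.isOpen_ball.mem_nhds (by simp))
  have h1 := (hasDerivAt_id (0 : ℂ)).mul (hd.hasDerivAt.const_mul
    (Complex.exp (lam * Complex.I) * (Real.cos lam : ℂ))).cexp
  have h2 := h1.deriv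
  simp only [id, h0, mul_zero, Complex.exp_zero, zero_mul, add_zero, one_mul] at h2
  exact h2

theorem spiralMap_zero_extremalExponent {z : ℂ} (hz : z ∈ Metric.ball (0 : ℂ) 1) :
    spiralMap 0 (extremalExponent a β) z = z * (1 - z) ^ (-(a : ℂ)) *
      (1 + ((1 : ℝ) : ℂ) * Complex.log (1 / (1 - z))) ^ (β : ℂ) := by
  have h1 : Complex.log (1 / (1 - z)) = -Complex.log (1 - z) := by
    rw [one_div, Complex.log_inv _ (Complex.slitPlane_arg_ne_pi (one_sub_mem_slitPlane hz))]
  rw [h1, Complex.ofReal_one, one_mul, ← sub_eq_add_neg,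
    Complex.cpow_def_of_ne_zero (one_sub_ne_zero hz),
    Complex.cpow_def_of_ne_zero (Complex.slitPlane_ne_zero (one_sub_log_mem_slitPlane hz)),
    mul_assoc, ← Complex.exp_add, spiralMap, extremalExponent]
  simp only [Complex.ofReal_zero, zero_mul, Complex.exp_zero, Real.cos_zero, Complex.ofReal_one,
    one_mul]
  ring_nf

theorem spiralMap_div_eq_cpow {lam : ℝ} {h : ℂ → ℂ} {z : ℂ} (hz : z ≠ 0) (him : |(h z).im| < π) :
    spiralMap lam h z / z =
      (spiralMap 0 h z / z) ^ (Complex.exp (lam * Complex.I) * (Real.cos lam : ℂ)) := by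
  have h1 : spiralMap 0 h z / z = Complex.exp (h z) := by
    simp [spiralMap, hz]
  obtain ⟨h2, h3⟩ := abs_lt.mp him
  rw [h1, Complex.cpow_def_of_ne_zero (Complex.exp_ne_zero _), Complex.log_exp h2 h3.le,
    spiralMap, mul_div_cancel_left₀ _ hz, mul_comm (h z)]

end Spirallike

theorem theorem3 (lam A : ℝ) (hlam : lam ∈ Set.Ioo (-(π / 2)) (π / 2))
    (hA : A ∈ Set.Ioo 0 (2 * π)) :
    ∃ f : ℂ → ℂ,
      Spirallike.IsSpirallike lam f ∧ deriv f 0 = 1 ∧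
      Spirallike.HasOpening f A ∧
      ¬ ((fun r : ℝ => Spirallike.maxModulus r f) =O[𝓝[<] 1]
          (fun r : ℝ => (1 - r) ^ (-(A * Real.cos lam ^ 2 / π)))) ∧
      -- the explicit form of `f`
      ∃ (g : ℂ → ℂ) (β c : ℝ), 0 < β ∧ 0 < c ∧ Spirallike.IsStarlike g ∧
        (∀ z ∈ Metric.ball (0 : ℂ) 1,
          g z = z * (1 - z) ^ (-((A / π : ℝ) : ℂ)) *
            (1 + (c : ℂ) * Complex.log (1 / (1 - z))) ^ (β : ℂ)) ∧
        (∀ z ∈ Metric.ball (0 : ℂ) 1, z ≠ 0 →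
          f z / z = (g z / z) ^ (Complex.exp (lam * Complex.I) * (Real.cos lam : ℂ))) := by
  open Spirallike in
  have hπ := Real.pi_pos
  have hc : 0 < Real.cos lam := Real.cos_pos_of_mem_Ioo hlam
  obtain ⟨a, ha⟩ : ∃ a, a = A / π := ⟨_, rfl⟩
  have hA' : A = a * π := by rw [ha]; field_simp
  have ha0 : 0 < a := by rw [ha]; exact div_pos hA.1 hπ
  have ha2 : a < 2 := by rw [ha, div_lt_iff₀ hπ]; exact hA.2
  obtain ⟨β, hβ⟩ : ∃ β, β = (2 - a) / 4 := ⟨_, rfl⟩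
  have hβ0 : 0 < β := by rw [hβ]; linarith
  have hstar := fun z (hz : z ∈ Metric.ball (0 : ℂ) 1) =>
    extremalExponent_starlike ha0 ha2 hβ hz
  have hdiff := differentiableOn_extremalExponent (a := a) (β := β)
  have hexp : A * Real.cos lam ^ 2 / π = a * Real.cos lam ^ 2 := by
    rw [ha]; ring
  rw [hexp, ← ha]
  refine ⟨spiralMap lam (extremalExponent a β), isSpirallike_spiralMap hc hdiff hstar,
    deriv_spiralMap_zero hdiff (by simp [extremalExponent]), ?_, not_isBigO_maxModulus hc hβ0,
    spiralMap 0 (extremalExponent a β), β, 1, hβ0, one_pos,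
    isSpirallike_spiralMap (by simp) hdiff hstar,
    fun z hz => spiralMap_zero_extremalExponent hz,
    fun z hz hz0 => spiralMap_div_eq_cpow hz0
      (abs_extremalExponent_im_lt ha0 hβ0 (by linarith) hz)⟩
  rw [hA']
  exact hasOpening_spiralMap hc ha0 ha2 hdiff hstar (fun δ hδ => extremalExponent_bounded hδ)
    tendsto_extremalExponent_im (tendsto_extremalExponent_re ha0 hβ0)
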